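/- Let $q$ be a prime power and let $n\le m$ be positive integers. The rank weight $\mathrm{rk}(\mathbf x)$ of $\mathbf x\in\mathrm{GF}(q^m)^n$ is the maximum number of coordinates of $\mathbf x$ that are linearly independent over $\mathrm{GF}(q)$, and $d_R(\mathbf x,\mathbf y)=\mathrm{rk}(\mathbf x-\mathbf y)$. Let $A_R(q^m,n,d,r)$ be the maximum cardinality of a nonempty set of vectors of rank weight $r$ in $\mathrm{GF}(q^m)^n$ such that any two distinct ones are at rank distance at least $d$. An $(n,n-d+1,d)$ linear MRD code is a $\mathrm{GF}(q^m)$-linear subspace of $\mathrm{GF}(q^m)^n$ of dimension $n-d+1$ with minimum rank distance $d$. Put $\alpha(n,r)=\prod_{i=0}^{r-1}(q^n-q^i)$, ${n\brack r}=\alpha(n,r)/\alpha(r,r)$, $M_{d,0}=1$, and for $r\ge 1$ $$M_{d,r}={n\brack r}\sum_{j=d}^{r}(-1)^{r-j}{r\brack j}q^{\binom{r-j}{2}}\left(q^{m(j-d+1)}-1\right)$$ (so $M_{d,r}=0$ for $1\le r<d$). Let $I_r=\{i: 0\le i\le n,\ |i-r|\ge d\}$ and, for $0\le a<d$, $J_a=I_r\cap\{a+kd: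 k\in\mathbb Z\}$. Then for all $1\le r,d\le n\le m$, $(n,n-d+1,d)$ linear MRD codes over $\mathrm{GF}(q^m)$ exist, each of them has exactly $M_{d,i}$ codewords of rank $i$ for every $0\le i\le n$, and \begin{align*} A_R(q^m,n,d,r)&\ge M_{d,r} &&\text{for } r\ge d,\\ A_R(q^m,n,d,r)&\le q^{m(n-d+1)}-\sum_{j\in J_a}A_R(q^m,n,d,j) &&\text{for every } 0\le a<d,\\ A_R(q^m,n,d,r)&\le q^{m(n-d+1)}-\sum_{i\in I_r}M_{d,i},\\ A_R(q^m,n,d,r)&\le q^{m(n-d+1)}-1 &&\text{for } r\ge d. \end{align*} -/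

import Mathlib

noncomputable section

/-- The rank weight of a vector `x` over the extension `K` of `F`: the maximum number of coordinates
of `x` that are linearly independent over `F`, i.e. the `F`-dimension of their span. -/
def rankWeight (F : Type*) {K : Type*} [Field F] [Field K] [Algebra F K] {n : ℕ}
    (x : Fin n → K) : ℕ :=
  Module.finrank F (Submodule.span F (Set.range x))

/-- The rank distance. -/
def rankDist (F : Type*) {K : Type*} [Field F] [Field K] [Algebra F K] {n : ℕ}
    (x y : Fin n → K) : ℕ :=
  rankWeight F (x - y)

/-- Constant-rank codes of length `n` and rank `r` over `K`, with rank distance at least `d` between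
distinct codewords (a code with one codeword is allowed). -/
def IsConstantRankCode (F : Type*) {K : Type*} [Field F] [Field K] [Algebra F K] {n : ℕ}
    (d r : ℕ) (C : Finset (Fin n → K)) : Prop :=
  C.Nonempty ∧ (∀ x ∈ C, rankWeight F x = r) ∧
    ∀ x ∈ C, ∀ y ∈ C, x ≠ y → d ≤ rankDist F x y

/-- The maximum cardinality of a constant-rank code. For finite `K` the set is bounded, and it is
nonempty as soon as `r ≤ n` and `r ≤ [K : F]`, so that the supremum is a maximum. -/
def maxConstantRankCode (F K : Type*) [Field F] [Field K] [Algebra F K] (n d r : ℕ) : ℕ :=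
  sSup {k : ℕ | ∃ C : Finset (Fin n → K), IsConstantRankCode F d r C ∧ C.card = k}

/-- `(n, n - d + 1, d)` linear MRD codes over `K`: `K`-linear codes of length `n` and
dimension `n - d + 1` whose minimum rank distance is `d`. -/
def IsLinearMRDCode (F : Type*) {K : Type*} [Field F] [Field K] [Algebra F K] {n : ℕ}
    (d : ℕ) (C : Submodule K (Fin n → K)) : Prop :=
  Module.finrank K C + d = n + 1 ∧
    IsLeast {t : ℕ | ∃ x ∈ C, ∃ y ∈ C, x ≠ y ∧ rankDist F x y = t} d

/-- `α(n, r) = ∏_{i < r} (q ^ n - q ^ i)`. -/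
def qAlpha (q n r : ℕ) : ℚ :=
  ∏ i ∈ Finset.range r, ((q : ℚ) ^ n - (q : ℚ) ^ i)

/-- The Gaussian polynomial. -/
def gaussianBinom (q n r : ℕ) : ℚ :=
  qAlpha q n r / qAlpha q r r

/-- The number `M_{d,r}` of codewords of rank `r` in an `(n, n - d + 1, d)` linear MRD code over
`GF(q ^ m)`. The closed formula is for `r ≥ 1` (it gives `0` if `1 ≤ r < d`); the zero word is the
only codeword of rank `0`. -/
def mrdRankCount (q m n d r : ℕ) : ℚ :=
  if r = 0 then 1
  else gaussianBinom q n r *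
    ∑ j ∈ Finset.Icc d r,
      (-1 : ℚ) ^ (r - j) * gaussianBinom q r j * (q : ℚ) ^ ((r - j).choose 2) *
        ((q : ℚ) ^ (m * (j - d + 1)) - 1)

/-- `I_r = {i : 0 ≤ i ≤ n, |i - r| ≥ d}`. -/
def rankSetI (n d r : ℕ) : Finset ℕ :=
  (Finset.range (n + 1)).filter fun i => (d : ℤ) ≤ |(i : ℤ) - (r : ℤ)|

open Classical in
/-- `J_a = I_r ∩ {a + k d : k ∈ ℤ}`. -/
def rankSetJ (n d r a : ℕ) : Finset ℕ :=
  (rankSetI n d r).filter fun j => ∃ k : ℤ, (j : ℤ) = (a : ℤ) + k * (d : ℤ)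

end

/-! The `GF(q)`-linear relations among the coordinates of `x` form a space of dimension `n - rk x`.
Hence `t` independent relations force rank at most `n - t`, and taking syndromes against `n - d + 1`
of them is injective on any code of distance `d`: the Singleton bound. Gabidulin codes attain it,
since a nonzero linearized polynomial has few roots.

On a linear MRD code every syndrome map with independent checks has full rank. Double counting pairs
(codeword, independent `t`-tuple annihilating it) then gives `∑ A_i α(n - i, t)`, with `A_i` the
number of words of rank `i`. These moments determine the `A_i` by triangularity, and `M_{d,i}` has
the same moments by q-binomial inversion (`sum_mrdRankCount_mul_qAlpha`).

For the bounds, the rank-`r` words of an MRD code form a constant-rank code. Conversely, words whose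
ranks differ by at least `d` are at distance at least `d`, so an optimal rank-`r` code can be
enlarged by optimal codes of ranks in `J_a`, or by MRD words of ranks in `I_r`, within the Singleton
bound. -/

/-! ### Gaussian binomials and the moments of `mrdRankCount`. -/

theorem qAlpha_zero (q n : ℕ) : qAlpha q n 0 = 1 := by simp [qAlpha]

theorem qAlpha_eq_zero {q n r : ℕ} (h : n < r) : qAlpha q n r = 0 :=
  Finset.prod_eq_zero (Finset.mem_range.2 h) (sub_self _)

theorem qAlpha_ne_zero {q n r : ℕ} (hq : 1 < q) (h : r ≤ n) : qAlpha q n r ≠ 0 := by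
  refine Finset.prod_ne_zero_iff.2 fun i hi => sub_ne_zero.2 fun e => ?_
  have : q ^ n = q ^ i := by exact_mod_cast e
  have := Nat.pow_right_injective hq this
  have := Finset.mem_range.1 hi
  omega

theorem qAlpha_add {q n a : ℕ} (h : a ≤ n) (b : ℕ) :
    qAlpha q n (a + b) = qAlpha q n a * ((q : ℚ) ^ (a * b) * qAlpha q (n - a) b) := by
  obtain ⟨c, rfl⟩ := Nat.exists_eq_add_of_le h
  unfold qAlpha
  rw [Finset.prod_range_add, Nat.add_sub_cancel_left]
  congr 1
  rw [pow_mul, ← Finset.card_range b, ← Finset.prod_const, Finset.card_range,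
    ← Finset.prod_mul_distrib]
  exact Finset.prod_congr rfl fun x _ => by ring

theorem gaussianBinom_zero_right (q n : ℕ) : gaussianBinom q n 0 = 1 := by
  simp [gaussianBinom, qAlpha_zero]

theorem gaussianBinom_eq_zero {q n r : ℕ} (h : n < r) : gaussianBinom q n r = 0 := by
  simp [gaussianBinom, qAlpha_eq_zero h]

theorem gaussianBinom_self {q n : ℕ} (hq : 1 < q) : gaussianBinom q n n = 1 :=
  div_self (qAlpha_ne_zero hq le_rfl)

/-- The `q`-Pascal recurrence. -/
theorem gaussianBinom_succ_succ {q : ℕ} (hq : 1 < q) (v s : ℕ) :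
    gaussianBinom q (v + 1) (s + 1) =
      gaussianBinom q v s + (q : ℚ) ^ (s + 1) * gaussianBinom q v (s + 1) := by
  have hq0 : (q : ℚ) ≠ 0 := by positivity
  have h1 : qAlpha q (v + 1) (s + 1) = ((q : ℚ) ^ (v + 1) - 1) * ((q : ℚ) ^ s * qAlpha q v s) := by
    rw [add_comm s, qAlpha_add (by omega)]
    simp [qAlpha]
  have h2 : qAlpha q (s + 1) (s + 1) =
      ((q : ℚ) ^ (s + 1) - 1) * ((q : ℚ) ^ s * qAlpha q s s) := by
    nth_rw 2 [add_comm s]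
    rw [qAlpha_add (by omega)]
    simp [qAlpha]
  have h3 : qAlpha q v (s + 1) = qAlpha q v s * ((q : ℚ) ^ v - (q : ℚ) ^ s) := by
    simp [qAlpha, Finset.prod_range_succ]
  have hs : qAlpha q s s ≠ 0 := qAlpha_ne_zero hq le_rfl
  have hs' : qAlpha q (s + 1) (s + 1) ≠ 0 := qAlpha_ne_zero hq le_rfl
  have hs1 : (q : ℚ) ^ (s + 1) - 1 ≠ 0 := by
    intro h
    exact hs' (by rw [h2, h, zero_mul])
  unfold gaussianBinom
  rw [h1, h2, h3]
  field_simp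
  ring

/-- The q-Pascal rule makes the sum telescope. The right side vanishes once `S > v`, which gives the
orthogonality below. -/
theorem sum_range_gaussianBinom {q : ℕ} (hq : 1 < q) (v S : ℕ) :
    ∑ s ∈ Finset.range (S + 1),
        (-1 : ℚ) ^ s * (q : ℚ) ^ (s.choose 2) * gaussianBinom q (v + 1) s =
      (-1 : ℚ) ^ S * (q : ℚ) ^ ((S + 1).choose 2) * gaussianBinom q v S := by
  induction S with
  | zero => simp [gaussianBinom_zero_right]
  | succ S ih =>
    rw [Finset.sum_range_succ, ih, gaussianBinom_succ_succ hq,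
      Nat.choose_succ_succ' (S + 1) 1, Nat.choose_one_right, pow_add]
    ring

/-- For a prime power `q`, both sides count flags of a `j`-space inside a `(j + s)`-space inside a
`u`-space. -/
theorem gaussianBinom_mul {q u j s : ℕ} (hq : 1 < q) (hj : j ≤ u) :
    gaussianBinom q u (j + s) * gaussianBinom q (j + s) j =
      gaussianBinom q u j * gaussianBinom q (u - j) s := by
  have hq0 : (q : ℚ) ≠ 0 := by positivity
  have h1 := qAlpha_ne_zero (r := j) hq le_rfl
  have h2 := qAlpha_ne_zero (r := s) hq le_rfl
  have h3 := qAlpha_ne_zero (n := j + s) (r := j) hq (by omega)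
  unfold gaussianBinom
  rw [qAlpha_add hj, qAlpha_add (n := j + s) (by omega), Nat.add_sub_cancel_left]
  field_simp

/-- Orthogonality of the Gaussian binomials. -/
theorem sum_gaussianBinom_mul {q : ℕ} (hq : 1 < q) {n u j : ℕ} (hu : u ≤ n) (hj : j ≤ n) :
    ∑ i ∈ Finset.Icc j n, gaussianBinom q u i *
        ((-1 : ℚ) ^ (i - j) * gaussianBinom q i j * (q : ℚ) ^ ((i - j).choose 2)) =
      if u = j then 1 else 0 := by
  rcases lt_or_ge u j with h | h
  · rw [if_neg h.ne]
    refine Finset.sum_eq_zero fun i hi => ?_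
    rw [gaussianBinom_eq_zero (h.trans_le (Finset.mem_Icc.1 hi).1), zero_mul]
  have e : ∑ i ∈ Finset.Icc j n, gaussianBinom q u i *
        ((-1 : ℚ) ^ (i - j) * gaussianBinom q i j * (q : ℚ) ^ ((i - j).choose 2)) =
      gaussianBinom q u j * ∑ s ∈ Finset.range (n - j + 1),
        (-1 : ℚ) ^ s * (q : ℚ) ^ (s.choose 2) * gaussianBinom q (u - j) s := by
    rw [← Finset.Ico_add_one_right_eq_Icc, Finset.sum_Ico_eq_sum_range, Finset.mul_sum,
      Nat.sub_add_comm hj]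
    refine Finset.sum_congr rfl fun s _ => ?_
    rw [Nat.add_sub_cancel_left]
    linear_combination (-1 : ℚ) ^ s * (q : ℚ) ^ (s.choose 2) * gaussianBinom_mul (s := s) hq h
  rw [e]
  obtain ⟨v, rfl⟩ := Nat.exists_eq_add_of_le h
  rw [Nat.add_sub_cancel_left]
  -- Here `v = u - j`. For `v = 0` only the term `s = 0` survives; for `v > 0` the alternating sum
  -- is complete because `u ≤ n`, and so it is zero.
  rcases v with _ | v
  · rw [Finset.sum_range_succ', Finset.sum_eq_zero]
    · simp [gaussianBinom_self hq]
    · intro s _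
      rw [gaussianBinom_eq_zero (by omega), mul_zero]
  · rw [sum_range_gaussianBinom hq, gaussianBinom_eq_zero (r := n - j) (by omega), mul_zero,
      mul_zero, if_neg (by omega)]

/-- Split `α(n, i + t)` after `i` factors and after `t` factors, then compare. -/
theorem gaussianBinom_mul_qAlpha {q n i t : ℕ} (hq : 1 < q) (hi : i ≤ n) (ht : t ≤ n) :
    gaussianBinom q n i * qAlpha q (n - i) t = qAlpha q n t * gaussianBinom q (n - t) i := by
  have hq0 : (q : ℚ) ≠ 0 := by positivity
  have h := (qAlpha_add (q := q) hi t).symm.trans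
    ((congrArg _ (add_comm i t)).trans (qAlpha_add (q := q) ht i))
  have h1 := qAlpha_ne_zero (r := i) hq le_rfl
  rw [mul_comm t i] at h
  unfold gaussianBinom
  field_simp
  refine mul_left_cancel₀ (pow_ne_zero (i * t) hq0) ?_
  linear_combination h

/-- The moments of the rank distribution `mrdRankCount`. -/
theorem sum_mrdRankCount_mul_qAlpha {q : ℕ} (hq : 1 < q) (m : ℕ) {n d t : ℕ} (hd : 1 ≤ d)
    (ht : t ≤ n) :
    ∑ i ∈ Finset.range (n + 1), mrdRankCount q m n d i * qAlpha q (n - i) t =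
      qAlpha q n t * (q : ℚ) ^ (m * (n + 1 - d - t)) := by
  have key : ∀ i ∈ Finset.range (n + 1), mrdRankCount q m n d i * qAlpha q (n - i) t =
      qAlpha q n t * ((if i = 0 then 1 else 0) + ∑ j ∈ Finset.Icc d i,
        ((q : ℚ) ^ (m * (j - d + 1)) - 1) * (gaussianBinom q (n - t) i *
          ((-1 : ℚ) ^ (i - j) * gaussianBinom q i j * (q : ℚ) ^ ((i - j).choose 2)))) := by
    intro i hi
    have hin : i ≤ n := by have := Finset.mem_range.1 hi; omega
    unfold mrdRankCount
    split_ifs with h0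
    · subst h0
      simp [Finset.Icc_eq_empty_of_lt (show 0 < d by omega)]
    · rw [mul_right_comm, gaussianBinom_mul_qAlpha hq hin ht, zero_add, mul_assoc, Finset.mul_sum]
      congr 1
      exact Finset.sum_congr rfl fun j _ => by ring
  rw [Finset.sum_congr rfl key, ← Finset.mul_sum, Finset.sum_add_distrib, Finset.sum_ite_eq',
    if_pos (by simp)]
  congr 1
  rw [Finset.sum_comm' (t' := Finset.Icc d n) (s' := fun j => Finset.Icc j n) (by
    intro x y
    simp only [Finset.mem_range, Finset.mem_Icc]
    omega)]
  -- With `j` outermost, orthogonality leaves only `j = n - t`.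
  rw [Finset.sum_congr rfl (g := fun j => if n - t = j then
    ((q : ℚ) ^ (m * (j - d + 1)) - 1) else 0) (by
      intro j hj
      rw [← Finset.mul_sum, sum_gaussianBinom_mul hq (by omega) (Finset.mem_Icc.1 hj).2]
      split_ifs <;> simp)]
  rw [Finset.sum_ite_eq]
  split_ifs with h
  · rw [Finset.mem_Icc] at h
    rw [show n - t - d + 1 = n + 1 - d - t by omega]
    ring
  -- Here `n - t < d`: only the zero word contributes, and the truncated exponent is `0`.
  · rw [Finset.mem_Icc] at h
    rw [show n + 1 - d - t = 0 by omega]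
    simp

/-- A sequence is determined by its moments against `qAlpha`. -/
theorem eq_of_sum_mul_qAlpha_eq {q n : ℕ} (hq : 1 < q) {A B : ℕ → ℚ}
    (h : ∀ t ≤ n, ∑ i ∈ Finset.range (n + 1), A i * qAlpha q (n - i) t =
      ∑ i ∈ Finset.range (n + 1), B i * qAlpha q (n - i) t) :
    ∀ i ≤ n, A i = B i := by
  intro i
  induction i using Nat.strong_induction_on with
  | _ i ih =>
    intro hi
    -- In the moment `t = n - i` the terms of index above `i` vanish and the coefficient at `i` does
    -- not, so the system is triangular.
    have h1 := h (n - i) (by omega)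
    have hmem : i ∈ Finset.range (n + 1) := Finset.mem_range.2 (by omega)
    rw [← Finset.add_sum_erase _ _ hmem, ← Finset.add_sum_erase _ (fun i => B i * _) hmem,
      Finset.sum_congr rfl (g := fun x => B x * qAlpha q (n - x) (n - i))] at h1
    · exact mul_right_cancel₀ (qAlpha_ne_zero hq le_rfl) (add_right_cancel h1)
    · intro x hx
      rw [Finset.mem_erase, Finset.mem_range] at hx
      rcases lt_or_gt_of_ne hx.1 with hlt | hgt
      · rw [ih x hlt (by omega)]
      · rw [qAlpha_eq_zero (by omega), mul_zero, mul_zero]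

/-! ### Rank weight, syndromes and the Singleton bound. -/

section

variable {F K : Type*} [Field F] [Field K] [Algebra F K] {n : ℕ}

/-- Rank-nullity for `v ↦ ∑ v_i x_i`, whose range is the span of the coordinates. -/
theorem finrank_ker_add_rankWeight (x : Fin n → K) :
    Module.finrank F (LinearMap.ker (Fintype.linearCombination F x)) + rankWeight F x = n := by
  have h := (Fintype.linearCombination F x).finrank_range_add_finrank_ker
  rw [Fintype.range_linearCombination, Module.finrank_fin_fun] at h
  unfold rankWeight
  omega

theorem rankWeight_le (x : Fin n → K) : rankWeight F x ≤ n := by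
  have := finrank_ker_add_rankWeight (F := F) x
  omega

@[simp]
theorem rankWeight_zero : rankWeight F (0 : Fin n → K) = 0 := by
  have : Submodule.span F (Set.range (0 : Fin n → K)) = ⊥ :=
    Submodule.span_eq_bot.2 (by rintro _ ⟨i, rfl⟩; rfl)
  rw [rankWeight, this, finrank_bot]

theorem rankWeight_neg (x : Fin n → K) : rankWeight F (-x) = rankWeight F x := by
  have h : Set.range (-x) = -Set.range x := by
    ext y
    simp [neg_eq_iff_eq_neg]
  rw [rankWeight, rankWeight, h, Submodule.span_neg]

theorem rankWeight_add_le (x y : Fin n → K) :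
    rankWeight F (x + y) ≤ rankWeight F x + rankWeight F y := by
  have hx := FiniteDimensional.span_of_finite F (Set.finite_range x)
  have hy := FiniteDimensional.span_of_finite F (Set.finite_range y)
  refine le_trans (Submodule.finrank_mono (Submodule.span_le.2 ?_))
    (Submodule.finrank_add_le_finrank_add_finrank _ _)
  rintro _ ⟨i, rfl⟩
  exact Submodule.add_mem_sup (Submodule.subset_span ⟨i, rfl⟩) (Submodule.subset_span ⟨i, rfl⟩)

theorem rankDist_comm (x y : Fin n → K) : rankDist F x y = rankDist F y x := by
  rw [rankDist, rankDist, ← rankWeight_neg, neg_sub]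

theorem rankWeight_le_add_rankDist (x y : Fin n → K) :
    rankWeight F x ≤ rankWeight F y + rankDist F x y := by
  have := rankWeight_add_le (F := F) y (x - y)
  rwa [add_sub_cancel] at this

/-- Distances dominate differences of rank weights. -/
theorem abs_rankWeight_sub_le (x y : Fin n → K) :
    |(rankWeight F x : ℤ) - rankWeight F y| ≤ rankDist F x y := by
  have h1 := rankWeight_le_add_rankDist (F := F) x y
  have h2 := rankWeight_le_add_rankDist (F := F) y x
  rw [rankDist_comm] at h2
  rw [abs_le]
  omega

variable (K) in
/-- The syndrome of vectors over `K` with respect to a family of vectors over `F`. -/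
noncomputable def syndrome {t : ℕ} (w : Fin t → Fin n → F) : (Fin n → K) →ₗ[K] (Fin t → K) :=
  Matrix.mulVecLin (Matrix.of fun i j => algebraMap F K (w i j))

theorem syndrome_apply {t : ℕ} (w : Fin t → Fin n → F) (x : Fin n → K) (i : Fin t) :
    syndrome K w x i = Fintype.linearCombination F x (w i) := by
  simp [syndrome, Matrix.mulVec, dotProduct, Fintype.linearCombination_apply, Algebra.smul_def]

theorem syndrome_eq_zero_iff {t : ℕ} (w : Fin t → Fin n → F) (x : Fin n → K) :
    syndrome K w x = 0 ↔ ∀ i, w i ∈ LinearMap.ker (Fintype.linearCombination F x) := by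
  simp [funext_iff, syndrome_apply]

theorem add_rankWeight_le_of_syndrome_eq_zero {t : ℕ} {w : Fin t → Fin n → F}
    (hw : LinearIndependent F w) {x : Fin n → K} (hx : syndrome K w x = 0) :
    t + rankWeight F x ≤ n := by
  rw [syndrome_eq_zero_iff] at hx
  have h : LinearIndependent F
      (fun i => (⟨w i, hx i⟩ : LinearMap.ker (Fintype.linearCombination F x))) :=
    LinearIndependent.of_comp (Submodule.subtype _) hw
  have h1 := h.fintype_card_le_finrank
  have h2 := finrank_ker_add_rankWeight (F := F) x
  rw [Fintype.card_fin] at h1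
  omega

theorem exists_linearIndependent_fin_fun {t : ℕ} (ht : t ≤ n) :
    ∃ w : Fin t → Fin n → F, LinearIndependent F w :=
  exists_linearIndependent_of_le_finrank (by rwa [Module.finrank_fin_fun])

/-- The Singleton bound for the rank distance. -/
theorem card_le_of_le_rankDist [Finite K] {d : ℕ} (hd : 1 ≤ d) (hdn : d ≤ n)
    {C : Finset (Fin n → K)} (hC : ∀ x ∈ C, ∀ y ∈ C, x ≠ y → d ≤ rankDist F x y) :
    C.card ≤ Nat.card K ^ (n - d + 1) := by
  have := Fintype.ofFinite K
  obtain ⟨w, hw⟩ := exists_linearIndependent_fin_fun (F := F) (n := n) (t := n - d + 1) (by omega)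
  have h : Set.InjOn (syndrome K w) C := by
    intro x hx y hy hxy
    by_contra hne
    have h1 := hC x hx y hy hne
    have h2 := add_rankWeight_le_of_syndrome_eq_zero hw (x := x - y) (by
      rw [map_sub, hxy, sub_self])
    rw [rankDist] at h1
    omega
  have := Finset.card_le_card_of_injOn (t := Finset.univ) _ (fun _ _ => Finset.mem_univ _) h
  simpa [Nat.card_eq_fintype_card] using this

theorem IsLinearMRDCode.le_rankWeight {d : ℕ} {C : Submodule K (Fin n → K)}
    (hC : IsLinearMRDCode F d C) {x : Fin n → K} (hx : x ∈ C) (h0 : x ≠ 0) :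
    d ≤ rankWeight F x :=
  hC.2.2 ⟨x, hx, 0, C.zero_mem, h0, by rw [rankDist, sub_zero]⟩

/-- A linear code of the right dimension and with no words of small rank is an MRD code. -/
theorem isLinearMRDCode_of_le_rankWeight {d : ℕ} (hdn : d ≤ n)
    {C : Submodule K (Fin n → K)} (hC : Module.finrank K C + d = n + 1)
    (h : ∀ x ∈ C, x ≠ 0 → d ≤ rankWeight F x) : IsLinearMRDCode F d C := by
  refine ⟨hC, ?_, ?_⟩
  -- One check fewer than the dimension of `C` leaves a nonzero word in the kernel; its rank is at
  -- most `d`, so the minimum is attained.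
  · obtain ⟨w, hw⟩ := exists_linearIndependent_fin_fun (F := F) (n := n) (t := n - d) (by omega)
    obtain ⟨x, hx, hx0⟩ := Submodule.exists_mem_ne_zero_of_ne_bot
      (LinearMap.ker_ne_bot_of_finrank_lt (f := (syndrome K w).domRestrict C)
        (by rw [Module.finrank_fin_fun]; omega))
    have h0 : (x : Fin n → K) ≠ 0 := by simpa using hx0
    refine ⟨x, x.2, 0, C.zero_mem, h0, ?_⟩
    have h1 := add_rankWeight_le_of_syndrome_eq_zero hw (x := (x : Fin n → K)) (by simpa using hx)
    have h2 := h x x.2 h0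
    rw [rankDist, sub_zero]
    omega
  · rintro _ ⟨x, hx, y, hy, hne, rfl⟩
    exact h _ (C.sub_mem hx hy) (sub_ne_zero.2 hne)

/-- The syndrome map of an MRD code has full rank. -/
theorem IsLinearMRDCode.syndrome_surjective {d : ℕ} {C : Submodule K (Fin n → K)}
    (hd : 1 ≤ d) (hC : IsLinearMRDCode F d C) {t : ℕ} (ht : t ≤ Module.finrank K C)
    {w : Fin t → Fin n → F} (hw : LinearIndependent F w) :
    Function.Surjective ((syndrome K w).domRestrict C) := by
  -- At `t = dim C` injectivity gives surjectivity. A shorter family is extended by one vector, and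
  -- the target is padded with `0`.
  induction ht using Nat.decreasingInduction with
  | self =>
    rw [← LinearMap.injective_iff_surjective_of_finrank_eq_finrank (Module.finrank_fin_fun K).symm,
      injective_iff_map_eq_zero]
    intro x hx
    by_contra h0
    have h1 := add_rankWeight_le_of_syndrome_eq_zero hw (x := (x : Fin n → K)) (by simpa using hx)
    have h2 := hC.le_rankWeight x.2 (by simpa using h0)
    have := hC.1
    omega
  | of_succ t ht ih =>
    have := hC.1
    obtain ⟨v, hv⟩ := exists_linearIndependent_snoc_of_lt_finrank hw
      (by rw [Module.finrank_fin_fun]; omega)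
    intro y
    obtain ⟨x, hx⟩ := ih hv (Fin.snoc y 0)
    refine ⟨x, funext fun i => ?_⟩
    have h1 := congrFun hx i.castSucc
    simpa [syndrome_apply] using h1

theorem IsLinearMRDCode.finrank_ker_syndrome {d : ℕ} {C : Submodule K (Fin n → K)}
    (hd : 1 ≤ d) (hC : IsLinearMRDCode F d C) {t : ℕ}
    {w : Fin t → Fin n → F} (hw : LinearIndependent F w) :
    Module.finrank K (LinearMap.ker ((syndrome K w).domRestrict C)) = n + 1 - d - t := by
  have := hC.1
  rcases le_total t (Module.finrank K C) with h | h
  · have h1 := ((syndrome K w).domRestrict C).finrank_range_add_finrank_ker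
    rw [LinearMap.range_eq_top.2 (hC.syndrome_surjective hd h hw), finrank_top,
      Module.finrank_fin_fun] at h1
    omega
  · rw [show n + 1 - d - t = 0 by omega, Submodule.finrank_eq_zero, Submodule.eq_bot_iff]
    intro x hx
    by_contra h0
    have h1 := add_rankWeight_le_of_syndrome_eq_zero hw (x := (x : Fin n → K)) (by simpa using hx)
    have h2 := hC.le_rankWeight x.2 (by simpa using h0)
    omega

end

/-! ### Rank distribution of linear MRD codes by double counting. -/

section

variable {F K : Type*} [Field F] [Field K] [Algebra F K] {n : ℕ}

theorem card_linearIndependent_eq_qAlpha (F : Type*) [Field F] [Finite F] {V : Type*}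
    [AddCommGroup V] [Module F V] [Finite V] (t : ℕ) :
    (Nat.card {s : Fin t → V // LinearIndependent F s} : ℚ) =
      qAlpha (Nat.card F) (Module.finrank F V) t := by
  have := Fintype.ofFinite F
  rcases le_or_gt t (Module.finrank F V) with h | h
  · rw [card_linearIndependent h, qAlpha, Fin.prod_univ_eq_prod_range
      (fun i => Fintype.card F ^ Module.finrank F V - Fintype.card F ^ i), Nat.card_eq_fintype_card,
      Nat.cast_prod]
    refine Finset.prod_congr rfl fun i hi => ?_
    have : i ≤ Module.finrank F V := by
      have := Finset.mem_range.1 hi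
      omega
    rw [Nat.cast_sub (Nat.pow_le_pow_right Fintype.card_pos this)]
    push_cast
    rfl
  · rw [qAlpha_eq_zero h, Nat.cast_eq_zero]
    refine @Nat.card_of_isEmpty _ ⟨fun s => ?_⟩
    have := s.2.fintype_card_le_finrank
    rw [Fintype.card_fin] at this
    omega

/-- The number of linearly independent families with which a given vector has zero syndrome. -/
theorem card_linearIndependent_syndrome_eq_zero [Finite F] (x : Fin n → K) (t : ℕ) :
    (Nat.card {w : {w : Fin t → Fin n → F // LinearIndependent F w} // syndrome K w.1 x = 0} : ℚ) =
      qAlpha (Nat.card F) (n - rankWeight F x) t := by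
  have h := finrank_ker_add_rankWeight (F := F) x
  rw [show n - rankWeight F x =
    Module.finrank F (LinearMap.ker (Fintype.linearCombination F x)) by omega,
    ← card_linearIndependent_eq_qAlpha]
  congr 1
  refine Nat.card_congr
    { toFun := fun w => ⟨fun i => ⟨w.1.1 i, (syndrome_eq_zero_iff _ _).1 w.2 i⟩,
        LinearIndependent.of_comp (Submodule.subtype _) w.1.2⟩
      invFun := fun s => ⟨⟨fun i => (s.1 i : Fin n → F),
        s.2.map' (Submodule.subtype _) (Submodule.ker_subtype _)⟩,
        (syndrome_eq_zero_iff _ _).2 fun i => (s.1 i).2⟩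
      left_inv := fun w => rfl
      right_inv := fun s => rfl }

/-- The moments of the rank distribution of a linear MRD code. -/
theorem IsLinearMRDCode.sum_ncard_mul_qAlpha [Finite F] [Finite K] {d : ℕ}
    {C : Submodule K (Fin n → K)} (hd : 1 ≤ d) (hC : IsLinearMRDCode F d C) (t : ℕ) :
    ∑ i ∈ Finset.range (n + 1), ({x : Fin n → K | x ∈ C ∧ rankWeight F x = i}.ncard : ℚ) *
        qAlpha (Nat.card F) (n - i) t =
      qAlpha (Nat.card F) n t * (Nat.card K : ℚ) ^ (n + 1 - d - t) := by
  classical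
  have := Fintype.ofFinite F
  have := Fintype.ofFinite K
  -- Pairs of a codeword and an independent `t`-tuple annihilating it are counted from both sides.
  have hcount := Finset.sum_card_bipartiteAbove_eq_sum_card_bipartiteBelow
    (s := (Finset.univ : Finset C))
    (t := (Finset.univ : Finset {w : Fin t → Fin n → F // LinearIndependent F w}))
    (fun (x : C) w => syndrome K w.1 (x : Fin n → K) = 0)
  have hright : ∀ w : {w : Fin t → Fin n → F // LinearIndependent F w},
      ((Finset.univ : Finset C).bipartiteBelow
        (fun (x : C) w => syndrome K w.1 (x : Fin n → K) = 0) w).card =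
        Nat.card K ^ (n + 1 - d - t) := by
    intro w
    rw [← hC.finrank_ker_syndrome hd w.2,
      ← Module.natCard_eq_pow_finrank (K := K) (V := LinearMap.ker ((syndrome K w.1).domRestrict C)),
      Nat.card_eq_fintype_card, Fintype.card_subtype]
    simp [Finset.bipartiteBelow]
  have hleft : ∀ x : C, (((Finset.univ :
      Finset {w : Fin t → Fin n → F // LinearIndependent F w}).bipartiteAbove
        (fun (x : C) w => syndrome K w.1 (x : Fin n → K) = 0) x).card : ℚ) =
        qAlpha (Nat.card F) (n - rankWeight F (x : Fin n → K)) t := by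
    intro x
    rw [← card_linearIndependent_syndrome_eq_zero, Nat.card_eq_fintype_card, Fintype.card_subtype]
    rfl
  have hcount' := congrArg (Nat.cast : ℕ → ℚ) hcount
  rw [Nat.cast_sum, Finset.sum_congr rfl fun x _ => hleft x,
    Finset.sum_congr rfl fun w _ => hright w, Finset.sum_const, Finset.card_univ,
    ← Nat.card_eq_fintype_card, smul_eq_mul, Nat.cast_mul, Nat.cast_pow,
    card_linearIndependent_eq_qAlpha, Module.finrank_fin_fun] at hcount'
  rw [← hcount', ← Finset.sum_fiberwise_of_maps_to (s := (Finset.univ : Finset C))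
    (t := Finset.range (n + 1)) (g := fun x => rankWeight F (x : Fin n → K))
    (fun x _ => Finset.mem_range.2 (Nat.lt_succ_of_le (rankWeight_le _)))]
  refine Finset.sum_congr rfl fun i _ => ?_
  rw [Finset.sum_congr rfl (g := fun _ => qAlpha (Nat.card F) (n - i) t)
    (fun x hx => by rw [(Finset.mem_filter.1 hx).2]), Finset.sum_const, nsmul_eq_mul]
  congr 2
  rw [← Finset.card_map (Function.Embedding.subtype (· ∈ C)), ← Set.ncard_coe_finset]
  congr 1
  ext x
  simp [and_comm]

/-- The rank distribution of a linear MRD code. -/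
theorem IsLinearMRDCode.ncard_eq_mrdRankCount [Finite F] [Finite K] {d : ℕ}
    {C : Submodule K (Fin n → K)} (hd : 1 ≤ d) (hC : IsLinearMRDCode F d C) {i : ℕ} (hi : i ≤ n) :
    ({x : Fin n → K | x ∈ C ∧ rankWeight F x = i}.ncard : ℚ) =
      mrdRankCount (Nat.card F) (Module.finrank F K) n d i := by
  refine eq_of_sum_mul_qAlpha_eq (A := fun i =>
    ({x : Fin n → K | x ∈ C ∧ rankWeight F x = i}.ncard : ℚ)) (Finite.one_lt_card (α := F))
    (fun t ht => ?_) i hi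
  rw [hC.sum_ncard_mul_qAlpha hd, sum_mrdRankCount_mul_qAlpha Finite.one_lt_card _ hd ht,
    Module.natCard_eq_pow_finrank (K := F) (V := K), Nat.cast_pow, pow_mul]

end

/-! ### Gabidulin codes. -/

section

variable {F K : Type*} [Field F] [Field K] [Algebra F K] {n : ℕ}

/-- The linearized polynomial `∑ i, a i * X ^ (q ^ i)`. -/
noncomputable def linearizedPolynomial (q : ℕ) {k : ℕ} (a : Fin k → K) : Polynomial K :=
  ∑ i, Polynomial.C (a i) * Polynomial.X ^ (q ^ (i : ℕ))

theorem linearizedPolynomial_natDegree_le {q : ℕ} (hq : 1 < q) {k : ℕ} (a : Fin k → K) :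
    (linearizedPolynomial q a).natDegree ≤ q ^ (k - 1) := by
  refine Polynomial.natDegree_sum_le_of_forall_le _ _ fun i _ =>
    (Polynomial.natDegree_C_mul_X_pow_le _ _).trans (Nat.pow_le_pow_right hq.le ?_)
  omega

theorem linearizedPolynomial_ne_zero {q : ℕ} (hq : 1 < q) {k : ℕ} {a : Fin k → K} (ha : a ≠ 0) :
    linearizedPolynomial q a ≠ 0 := by
  obtain ⟨i, hi⟩ := Function.ne_iff.1 ha
  intro h
  have h1 := congrArg (fun p => Polynomial.coeff p (q ^ (i : ℕ))) h
  simp only [linearizedPolynomial, Polynomial.finsetSum_coeff, Polynomial.coeff_C_mul_X_pow,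
    Polynomial.coeff_zero] at h1
  rw [Finset.sum_eq_single i] at h1
  · exact hi (by simpa using h1)
  · intro j _ hj
    exact if_neg fun e => hj (Fin.ext (Nat.pow_right_injective hq e.symm))
  · simp

/-- The encoder of the Gabidulin code with evaluation points `g`. -/
noncomputable def gabidulinEncoder (q k : ℕ) (g : Fin n → K) : (Fin k → K) →ₗ[K] (Fin n → K) :=
  Matrix.mulVecLin (Matrix.of fun j i => g j ^ (q ^ (i : ℕ)))

/-- Powers of Frobenius are `F`-linear, so relations among the coordinates of a codeword correspond
to roots of its polynomial in the span of `g`. -/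
theorem linearCombination_gabidulinEncoder [Finite F] {k : ℕ} (g : Fin n → K) (a : Fin k → K)
    (v : Fin n → F) :
    Fintype.linearCombination F (gabidulinEncoder (Nat.card F) k g a) v =
      (linearizedPolynomial (Nat.card F) a).eval (Fintype.linearCombination F g v) := by
  have := Fintype.ofFinite F
  have hpow : ∀ (i : ℕ) (y : K), (FiniteField.frobeniusAlgHom F K ^ i) y = y ^ Nat.card F ^ i := by
    intro i y
    rw [AlgHom.coe_pow, FiniteField.coe_frobeniusAlgHom, pow_iterate, Nat.card_eq_fintype_card]
  simp only [linearizedPolynomial, gabidulinEncoder, Polynomial.eval_finsetSum,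
    Polynomial.eval_mul, Polynomial.eval_C, Polynomial.eval_pow, Polynomial.eval_X, ← hpow,
    Fintype.linearCombination_apply, map_sum, map_smul, Matrix.mulVecLin_apply, Matrix.mulVec,
    dotProduct, Matrix.of_apply, Finset.smul_sum, Finset.mul_sum]
  rw [Finset.sum_comm]
  exact Finset.sum_congr rfl fun i _ => Finset.sum_congr rfl fun j _ => by
    rw [mul_smul_comm, mul_comm]

theorem le_rankWeight_gabidulinEncoder [Finite F] {k : ℕ} {g : Fin n → K}
    (hg : LinearIndependent F g) {a : Fin k → K} (ha : a ≠ 0) :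
    n ≤ rankWeight F (gabidulinEncoder (Nat.card F) k g a) + (k - 1) := by
  classical
  have hq : 1 < Nat.card F := Finite.one_lt_card
  have hP := linearizedPolynomial_ne_zero hq ha
  set N := LinearMap.ker (Fintype.linearCombination F (gabidulinEncoder (Nat.card F) k g a))
  have hinj : Function.Injective (Fintype.linearCombination F g) :=
    linearIndependent_iff_injective_fintypeLinearCombination.1 hg
  -- The relation space embeds in the root set, which has at most `q ^ (k - 1)` elements; hence its
  -- dimension is at most `k - 1`.
  let f : N → ((linearizedPolynomial (Nat.card F) a).roots.toFinset : Set K) := fun v =>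
    ⟨Fintype.linearCombination F g v.1, by
      have := v.2
      simp only [N, LinearMap.mem_ker, linearCombination_gabidulinEncoder] at this
      simpa [hP] using this⟩
  have hf : Function.Injective f := fun v w h => Subtype.ext (hinj (congrArg Subtype.val h))
  have h1 := Nat.card_le_card_of_injective f hf
  rw [Module.natCard_eq_pow_finrank (K := F), Nat.card_coe_set_eq, Set.ncard_coe_finset] at h1
  have h2 := (Nat.pow_le_pow_iff_right hq).1 (h1.trans ((Multiset.toFinset_card_le _).trans
    ((Polynomial.card_roots' _).trans (linearizedPolynomial_natDegree_le hq a))))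
  have h3 := finrank_ker_add_rankWeight (F := F) (gabidulinEncoder (Nat.card F) k g a)
  change Module.finrank F N + _ = n at h3
  omega

/-- Gabidulin codes are linear MRD codes. -/
theorem isLinearMRDCode_range_gabidulinEncoder [Finite F] {d : ℕ} (hd : 1 ≤ d) (hdn : d ≤ n)
    {g : Fin n → K} (hg : LinearIndependent F g) :
    IsLinearMRDCode F d (LinearMap.range (gabidulinEncoder (Nat.card F) (n + 1 - d) g)) := by
  have hinj : Function.Injective (gabidulinEncoder (Nat.card F) (n + 1 - d) g) := by
    rw [injective_iff_map_eq_zero]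
    intro a ha
    by_contra h0
    have := le_rankWeight_gabidulinEncoder hg h0
    rw [ha, rankWeight_zero] at this
    omega
  refine isLinearMRDCode_of_le_rankWeight hdn ?_ ?_
  · rw [LinearMap.finrank_range_of_inj hinj, Module.finrank_fin_fun]
    omega
  · rintro _ ⟨a, rfl⟩ h0
    have := le_rankWeight_gabidulinEncoder hg (a := a) (by rintro rfl; exact h0 (map_zero _))
    omega

theorem exists_isLinearMRDCode [Finite F] {d : ℕ} (hd : 1 ≤ d) (hdn : d ≤ n)
    (hn : n ≤ Module.finrank F K) : ∃ C : Submodule K (Fin n → K), IsLinearMRDCode F d C := by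
  obtain ⟨g, hg⟩ := exists_linearIndependent_of_le_finrank hn
  exact ⟨_, isLinearMRDCode_range_gabidulinEncoder hd hdn hg⟩

end

/-! ### Bounds for constant-rank codes. -/

section

variable {F K : Type*} [Field F] [Field K] [Algebra F K] {n : ℕ}

theorem bddAbove_card_constantRankCode [Finite K] (d r : ℕ) :
    BddAbove {k : ℕ | ∃ C : Finset (Fin n → K), IsConstantRankCode F d r C ∧ C.card = k} := by
  have := Fintype.ofFinite K
  refine ⟨Fintype.card (Fin n → K), ?_⟩
  rintro _ ⟨C, -, rfl⟩
  exact C.card_le_univ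

theorem card_le_maxConstantRankCode [Finite K] {d r : ℕ} {C : Finset (Fin n → K)}
    (hr : ∀ x ∈ C, rankWeight F x = r)
    (hC : ∀ x ∈ C, ∀ y ∈ C, x ≠ y → d ≤ rankDist F x y) :
    C.card ≤ maxConstantRankCode F K n d r := by
  rcases C.eq_empty_or_nonempty with rfl | h
  · exact Nat.zero_le _
  · exact le_csSup (bddAbove_card_constantRankCode d r) ⟨C, ⟨h, hr, hC⟩, rfl⟩

variable (F K n) in
theorem exists_card_eq_maxConstantRankCode [Finite K] (d r : ℕ) :
    ∃ C : Finset (Fin n → K), (∀ x ∈ C, rankWeight F x = r) ∧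
      (∀ x ∈ C, ∀ y ∈ C, x ≠ y → d ≤ rankDist F x y) ∧
      C.card = maxConstantRankCode F K n d r := by
  rcases Set.eq_empty_or_nonempty
    {k : ℕ | ∃ C : Finset (Fin n → K), IsConstantRankCode F d r C ∧ C.card = k} with h | h
  -- If no code of rank `r` exists, the supremum takes its default value `0`, attained by the empty
  -- set.
  · exact ⟨∅, by simp, by simp, by rw [maxConstantRankCode, h, csSup_empty]; rfl⟩
  · obtain ⟨C, hC, hcard⟩ := Nat.sSup_mem h (bddAbove_card_constantRankCode d r)
    exact ⟨C, hC.2.1, hC.2.2, hcard⟩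

/-- Codes whose rank weights are far apart have a total size within the Singleton bound. -/
theorem sum_card_le_of_le_abs_sub [Finite K] {d : ℕ} (hd : 1 ≤ d) (hdn : d ≤ n) {S : Finset ℕ}
    (hS : ∀ i ∈ S, ∀ j ∈ S, i ≠ j → (d : ℤ) ≤ |(i : ℤ) - j|) {D : ℕ → Finset (Fin n → K)}
    (hr : ∀ i ∈ S, ∀ x ∈ D i, rankWeight F x = i)
    (hD : ∀ i ∈ S, ∀ x ∈ D i, ∀ y ∈ D i, x ≠ y → d ≤ rankDist F x y) :
    ∑ i ∈ S, (D i).card ≤ Nat.card K ^ (n - d + 1) := by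
  classical
  rw [← Finset.card_biUnion]
  · refine card_le_of_le_rankDist (F := F) hd hdn fun x hx y hy hne => ?_
    obtain ⟨i, hi, hx⟩ := Finset.mem_biUnion.1 hx
    obtain ⟨j, hj, hy⟩ := Finset.mem_biUnion.1 hy
    by_cases hij : i = j
    · subst hij
      exact hD i hi x hx y hy hne
    · have h1 := hS i hi j hj hij
      have h2 := abs_rankWeight_sub_le (F := F) x y
      rw [hr i hi x hx, hr j hj y hy] at h2
      exact_mod_cast h1.trans h2
  · intro i hi j hj hij
    refine Finset.disjoint_left.2 fun x hx hx' => hij ?_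
    rw [← hr i hi x hx, ← hr j hj x hx']

theorem le_abs_sub_of_mem_rankSetI {n d r i : ℕ} (h : i ∈ rankSetI n d r) :
    (d : ℤ) ≤ |(i : ℤ) - r| :=
  (Finset.mem_filter.1 h).2

theorem notMem_rankSetI {n d r : ℕ} (hd : 1 ≤ d) : r ∉ rankSetI n d r := by
  intro h
  have := le_abs_sub_of_mem_rankSetI h
  rw [sub_self, abs_zero] at this
  omega

theorem mem_rankSetJ {n d r a j : ℕ} :
    j ∈ rankSetJ n d r a ↔ j ∈ rankSetI n d r ∧ ∃ k : ℤ, (j : ℤ) = (a : ℤ) + k * (d : ℤ) := by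
  simp [rankSetJ]

theorem le_abs_sub_of_mem_rankSetJ {n d r a i j : ℕ} (hi : i ∈ rankSetJ n d r a)
    (hj : j ∈ rankSetJ n d r a) (hij : i ≠ j) : (d : ℤ) ≤ |(i : ℤ) - j| := by
  obtain ⟨k, hk⟩ := (mem_rankSetJ.1 hi).2
  obtain ⟨l, hl⟩ := (mem_rankSetJ.1 hj).2
  -- Distinct integers congruent modulo `d` differ by at least `d`.
  refine Int.le_of_dvd (abs_pos.2 (sub_ne_zero.2 (by exact_mod_cast hij))) ((dvd_abs _ _).2 ?_)
  exact ⟨k - l, by rw [hk, hl]; ring⟩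

/-- The bound given by optimal constant-rank codes of ranks in a residue class. -/
theorem maxConstantRankCode_add_sum_rankSetJ_le [Finite K] {d : ℕ} (hd : 1 ≤ d) (hdn : d ≤ n)
    (r a : ℕ) :
    maxConstantRankCode F K n d r + ∑ j ∈ rankSetJ n d r a, maxConstantRankCode F K n d j ≤
      Nat.card K ^ (n - d + 1) := by
  choose D hr hD hcard using exists_card_eq_maxConstantRankCode F K n d
  have hnot : r ∉ rankSetJ n d r a := fun h => notMem_rankSetI hd (mem_rankSetJ.1 h).1
  have hI : ∀ i ∈ rankSetJ n d r a, (d : ℤ) ≤ |(i : ℤ) - r| := fun i hi =>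
    le_abs_sub_of_mem_rankSetI (mem_rankSetJ.1 hi).1
  simp only [← hcard]
  rw [← Finset.sum_insert (f := fun i => (D i).card) hnot]
  refine sum_card_le_of_le_abs_sub (F := F) hd hdn (fun i hi j hj hij => ?_)
    (fun i _ => hr i) (fun i _ => hD i)
  rcases Finset.mem_insert.1 hi with rfl | hi <;> rcases Finset.mem_insert.1 hj with rfl | hj
  · exact absurd rfl hij
  · rw [abs_sub_comm]
    exact hI j hj
  · exact hI i hi
  · exact le_abs_sub_of_mem_rankSetJ hi hj hij

/-- The bound given by the words of an MRD code whose ranks are far from a given one. -/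
theorem IsLinearMRDCode.maxConstantRankCode_add_sum_ncard_le [Finite K] {d : ℕ} (hd : 1 ≤ d)
    (hdn : d ≤ n) {C : Submodule K (Fin n → K)} (hC : IsLinearMRDCode F d C) (r : ℕ) :
    maxConstantRankCode F K n d r +
        ∑ i ∈ rankSetI n d r, {x : Fin n → K | x ∈ C ∧ rankWeight F x = i}.ncard ≤
      Nat.card K ^ (n - d + 1) := by
  classical
  have := Fintype.ofFinite K
  obtain ⟨D, hr, hD, hcard⟩ := exists_card_eq_maxConstantRankCode F K n d r
  set E : Finset (Fin n → K) :=
    Finset.univ.filter fun x => x ∈ C ∧ rankWeight F x ∈ rankSetI n d r with hE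
  have hEcard : ∑ i ∈ rankSetI n d r, {x : Fin n → K | x ∈ C ∧ rankWeight F x = i}.ncard =
      E.card := by
    rw [Finset.card_eq_sum_card_fiberwise (t := rankSetI n d r) (f := fun x => rankWeight F x)
      (fun x hx => (Finset.mem_filter.1 hx).2.2)]
    refine Finset.sum_congr rfl fun i hi => ?_
    rw [← Set.ncard_coe_finset]
    congr 1
    ext x
    simp only [Set.mem_ofPred_eq, Finset.coe_filter, hE, Finset.mem_filter, Finset.mem_univ,
      true_and]
    constructor
    · rintro ⟨h1, rfl⟩
      exact ⟨⟨h1, hi⟩, rfl⟩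
    · rintro ⟨⟨h1, -⟩, h2⟩
      exact ⟨h1, h2⟩
  have hfar : ∀ x ∈ E, ∀ y ∈ D, d ≤ rankDist F x y := by
    intro x hx y hy
    have h1 := le_abs_sub_of_mem_rankSetI (Finset.mem_filter.1 hx).2.2
    rw [← hr y hy] at h1
    exact_mod_cast h1.trans (abs_rankWeight_sub_le x y)
  have hdisj : Disjoint D E := by
    refine Finset.disjoint_left.2 fun x hx hx' => notMem_rankSetI (n := n) (r := r) hd ?_
    have := (Finset.mem_filter.1 hx').2.2
    rwa [hr x hx] at this
  rw [hEcard, ← hcard, ← Finset.card_union_of_disjoint hdisj]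
  refine card_le_of_le_rankDist (F := F) hd hdn fun x hx y hy hne => ?_
  rcases Finset.mem_union.1 hx with hx | hx <;> rcases Finset.mem_union.1 hy with hy | hy
  · exact hD x hx y hy hne
  · rw [rankDist_comm]
    exact hfar y hy x hx
  · exact hfar x hx y hy
  · exact hC.le_rankWeight (C.sub_mem (Finset.mem_filter.1 hx).2.1 (Finset.mem_filter.1 hy).2.1)
      (sub_ne_zero.2 hne)

theorem IsLinearMRDCode.ncard_le_maxConstantRankCode [Finite K] {d : ℕ}
    {C : Submodule K (Fin n → K)} (hC : IsLinearMRDCode F d C) (r : ℕ) :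
    {x : Fin n → K | x ∈ C ∧ rankWeight F x = r}.ncard ≤ maxConstantRankCode F K n d r := by
  classical
  have := Fintype.ofFinite K
  rw [Set.ncard_eq_toFinset_card']
  refine card_le_maxConstantRankCode (F := F) (fun x hx => ?_) fun x hx y hy hne => ?_
  · exact (Set.mem_toFinset.1 hx).2
  · exact hC.le_rankWeight (C.sub_mem (Set.mem_toFinset.1 hx).1 (Set.mem_toFinset.1 hy).1)
      (sub_ne_zero.2 hne)

end

/-! ### The main theorem. -/

theorem mainTheorem4 {F K : Type*} [Field F] [Finite F] [Field K] [Finite K] [Algebra F K]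
    (q m n d r : ℕ) (hq : Nat.card F = q) (hm : Module.finrank F K = m)
    (hr : 1 ≤ r) (hrn : r ≤ n) (hd : 1 ≤ d) (hdn : d ≤ n) (hnm : n ≤ m) :
    -- linear MRD codes exist, and `M_{d,i}` counts the codewords of rank `i` in each of them
    ((∃ C : Submodule K (Fin n → K), IsLinearMRDCode F d C) ∧
      ∀ C : Submodule K (Fin n → K), IsLinearMRDCode F d C → ∀ i ≤ n,
        (({x : Fin n → K | x ∈ C ∧ rankWeight F x = i}.ncard : ℕ) : ℚ) =
          mrdRankCount q m n d i) ∧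
    (d ≤ r → mrdRankCount q m n d r ≤ (maxConstantRankCode F K n d r : ℚ)) ∧
    (∀ a < d, (maxConstantRankCode F K n d r : ℚ) ≤
      (q : ℚ) ^ (m * (n - d + 1)) -
        ∑ j ∈ rankSetJ n d r a, (maxConstantRankCode F K n d j : ℚ)) ∧
    ((maxConstantRankCode F K n d r : ℚ) ≤
      (q : ℚ) ^ (m * (n - d + 1)) - ∑ i ∈ rankSetI n d r, mrdRankCount q m n d i) ∧
    (d ≤ r → (maxConstantRankCode F K n d r : ℚ) ≤ (q : ℚ) ^ (m * (n - d + 1)) - 1) := by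
  subst hq hm
  obtain ⟨C, hC⟩ := exists_isLinearMRDCode (F := F) (K := K) hd hdn hnm
  have hcount : ∀ C : Submodule K (Fin n → K), IsLinearMRDCode F d C → ∀ i ≤ n,
      (({x : Fin n → K | x ∈ C ∧ rankWeight F x = i}.ncard : ℕ) : ℚ) =
        mrdRankCount (Nat.card F) (Module.finrank F K) n d i :=
    fun C hC i hi => hC.ncard_eq_mrdRankCount hd hi
  have hcard : (Nat.card F : ℚ) ^ (Module.finrank F K * (n - d + 1)) =
      ((Nat.card K ^ (n - d + 1) : ℕ) : ℚ) := by
    rw [Module.natCard_eq_pow_finrank (K := F) (V := K), ← pow_mul, Nat.cast_pow]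
  have hI : ∀ i ∈ rankSetI n d r, i ≤ n := fun i hi =>
    Nat.lt_succ_iff.1 (Finset.mem_range.1 (Finset.mem_filter.1 hi).1)
  have hmrd : (maxConstantRankCode F K n d r : ℚ) +
      ∑ i ∈ rankSetI n d r, mrdRankCount (Nat.card F) (Module.finrank F K) n d i ≤
        ((Nat.card K ^ (n - d + 1) : ℕ) : ℚ) := by
    rw [← Finset.sum_congr rfl fun i hi => hcount C hC i (hI i hi)]
    exact_mod_cast hC.maxConstantRankCode_add_sum_ncard_le hd hdn r
  rw [hcard]
  refine ⟨⟨⟨C, hC⟩, hcount⟩, fun _ => ?_, fun a _ => ?_, le_sub_iff_add_le.2 hmrd, fun hdr => ?_⟩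
  · rw [← hcount C hC r hrn]
    exact_mod_cast hC.ncard_le_maxConstantRankCode r
  · rw [le_sub_iff_add_le]
    exact_mod_cast maxConstantRankCode_add_sum_rankSetJ_le (F := F) (K := K) hd hdn r a
  -- For `r ≥ d` the zero word lies in the MRD part, and the other counts are nonnegative.
  · have h0 : 0 ∈ rankSetI n d r := by simpa [rankSetI] using hdr
    have h1 := Finset.single_le_sum
      (f := fun i => mrdRankCount (Nat.card F) (Module.finrank F K) n d i)
      (fun i hi => by rw [← hcount C hC i (hI i hi)]; exact Nat.cast_nonneg _) h0
    have h2 : mrdRankCount (Nat.card F) (Module.finrank F K) n d 0 = 1 := if_pos rfl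
    simp only [h2] at h1
    linarith
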